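/- Let $m \ge 1$, $n_1,\dots,n_m \ge 1$, $n = n_1+\cdots+n_m$ and $t_0 \in \mathbb{R}$. Consider the interconnected nonlinear time-varying system $$\dot x_i = f_i(t, x_1,\dots,x_m), \qquad t \ge t_0,\quad i \in \{1,\dots,m\},$$ with $x_i \in \mathbb{R}^{n_i}$, $x = (x_1,\dots,x_m) \in \mathbb{R}^n$ and $f = (f_1,\dots,f_m)$. Assume that $f(t,x)$ is piecewise continuous in $t$ (with breakpoints that do not depend on $x$ and do not accumulate, and jointly continuous in $(t,x)$ up to the breakpoints between consecutive ones), that it is continuously differentiable in $x$ with a Jacobian matrix that is bounded on compact sets of $(t,x) \in [t_0,\infty) \times \mathbb{R}^n$ (as when the Jacobian is piecewise continuous in $t$ as well), and that for each $x \in \mathbb{R}^n$ the solution $t \mapsto \xi(t,t_0,x)$ with initial state $x$ at time $t_0$ exists on $[t_0,\infty)$. Let $K \subset \mathbb{R}^n$ be compact with nonempty interior, let $\xi(t,t_0,K) = \{\xi(t,t_0,x) : x \in K\}$ be the reachable set, let $|\cdot|$ be any norm on $\mathbb{R}^n$, and let $S(f,t_0,\varepsilon,T,K)$ be the minimal cardinality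 of a set $E \subset K$ such that for every $\bar x \in K$ there is $x \in E$ with $|\xi(t,t_0,\bar x) - \xi(t,t_0,x)| < \varepsilon$ for all $t \in [t_0,t_0+T]$. The topological entropy is $$h(f,t_0,K) = \lim_{\varepsilon \searrow 0}\, \limsup_{T\to\infty} \frac1T \log S(f,t_0,\varepsilon,T,K) \in [0,\infty].$$ Let $|\cdot|_i$ be a norm on $\mathbb{R}^{n_i}$ for each $i$, and let $|\cdot|_{\mathrm N}$ be a norm on $\mathbb{R}^m$ that is monotone: $v \ge w$ entrywise implies $|v|_{\mathrm N} \ge |w|_{\mathrm N}$ for all entrywise nonnegative $v, w \in \mathbb{R}^m$. Let $\mu_i$ and $\mu_{\mathrm N}$ be the corresponding matrix measures, where the matrix measure for an induced matrix norm $\|\cdot\|$ is $\mu(A) = \lim_{s \searrow 0} (\|I + sA\| - 1)/s$, and let $\|A\|_{ij} = \max_{|v|_j = 1} |Av|_i$ for $A \in \mathbb{R}^{n_i \times n_j}$. Define the interconnection matrix $A_{\mathrm N}(t,x) = [a_{ij}(t,x)] \in \mathbb{R}^{m\times m}$ by $$a_{ii}(t,x) = \mu_i\!\left(\frac{\partial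 f_i}{\partial x_i}(t,x)\right), \qquad a_{ij}(t,x) = \left\|\frac{\partial f_i}{\partial x_j}(t,x)\right\|_{ij} \quad (i \ne j).$$ Then $$h(f,t_0,K) \le n \max\{\hat\mu_{\mathrm N}, 0\}, \qquad \hat\mu_{\mathrm N} := \limsup_{t\to\infty}\ \max_{v \in \mathrm{co}(\xi(t,t_0,K))} \mu_{\mathrm N}(A_{\mathrm N}(t,v)) \in [-\infty,\infty],$$ where $\mathrm{co}$ denotes the convex hull. -/

import Mathlib

open Set Filter Topology

noncomputable section

namespace InterEntropy

/-! ### Norms, induced norms and matrix measures -/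

/-- A seminorm on a real vector space is a norm if it vanishes only at the origin. -/
def IsNorm {V : Type*} [AddCommGroup V] [Module ℝ V] (p : Seminorm ℝ V) : Prop :=
  ∀ v, p v = 0 → v = 0

/-- A norm on `ℝ^m` is monotone if `v ≥ w` implies `|v| ≥ |w|` for entrywise nonnegative
vectors `v`, `w`. -/
def IsMonotone {m : ℕ} (p : Seminorm ℝ (Fin m → ℝ)) : Prop :=
  ∀ v w : Fin m → ℝ, 0 ≤ v → 0 ≤ w → w ≤ v → p w ≤ p v

/-- The (mixed) induced norm `max_{|v|_p = 1} |A v|_q` of a matrix `A`, for norms `p` on the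
domain and `q` on the codomain. -/
def inducedNorm {k l : ℕ} (p : Seminorm ℝ (Fin l → ℝ)) (q : Seminorm ℝ (Fin k → ℝ))
    (A : Matrix (Fin k) (Fin l) ℝ) : ℝ :=
  sSup {r : ℝ | ∃ v : Fin l → ℝ, p v = 1 ∧ r = q (A.mulVec v)}

/-- The matrix measure (logarithmic norm) `lim_{s ↘ 0} (‖I + s A‖ - 1) / s` of a square matrix,
where `‖·‖` is the norm on matrices induced by the norm `p`. -/
def matrixMeasure {k : ℕ} (p : Seminorm ℝ (Fin k → ℝ)) (A : Matrix (Fin k) (Fin k) ℝ) : ℝ :=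
  limUnder (𝓝[>] (0 : ℝ)) fun s : ℝ => (inducedNorm p p (1 + s • A) - 1) / s

theorem bddAbove_inducedNorm {k l : ℕ} {p : Seminorm ℝ (Fin l → ℝ)} (hp : IsNorm p)
    (q : Seminorm ℝ (Fin k → ℝ)) (A : Matrix (Fin k) (Fin l) ℝ) :
    BddAbove {r : ℝ | ∃ v : Fin l → ℝ, p v = 1 ∧ r = q (A.mulVec v)} := by
  have hpc : Continuous p := continuousOn_univ.1 (p.convexOn.continuousOn isOpen_univ)
  have hqc : Continuous q := continuousOn_univ.1 (q.convexOn.continuousOn isOpen_univ)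
  have hqA : Continuous fun v : Fin l → ℝ => q (A.mulVec v) :=
    hqc.comp (Continuous.matrix_mulVec continuous_const continuous_id)
  obtain ⟨M, hM⟩ := (isCompact_sphere (0 : Fin l → ℝ) 1).bddAbove_image hqA.continuousOn
  rcases (Metric.sphere (0 : Fin l → ℝ) 1).eq_empty_or_nonempty with he | hne
  · refine ⟨0, ?_⟩
    rintro r ⟨v, hv, rfl⟩
    exfalso
    have hv0 : v ≠ 0 := by rintro rfl; simp at hv
    have : (‖v‖⁻¹ • v) ∈ Metric.sphere (0 : Fin l → ℝ) 1 := by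
      simp [norm_smul, hv0]
    rw [he] at this
    exact this
  obtain ⟨u, hu, hmin⟩ := (isCompact_sphere (0 : Fin l → ℝ) 1).exists_isMinOn hne hpc.continuousOn
  have hu0 : u ≠ 0 := by rintro rfl; simp at hu
  have hc : 0 < p u := lt_of_le_of_ne (apply_nonneg p u) fun h => hu0 (hp u h.symm)
  have hM0 : 0 ≤ M := (apply_nonneg q _).trans (hM ⟨u, hu, rfl⟩)
  refine ⟨M / p u, ?_⟩
  rintro r ⟨v, hv, rfl⟩
  have hv0 : v ≠ 0 := by rintro rfl; simp at hv
  have hnv : 0 < ‖v‖ := norm_pos_iff.2 hv0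
  have hw : (‖v‖⁻¹ • v) ∈ Metric.sphere (0 : Fin l → ℝ) 1 := by
    simp [norm_smul, hv0]
  have h1 : p u ≤ ‖v‖⁻¹ := by
    have := hmin hw
    simpa [map_smul_eq_mul, hv] using this
  have h2 : ‖v‖⁻¹ * q (A.mulVec v) ≤ M := by
    have := hM ⟨_, hw, rfl⟩
    simpa [Matrix.mulVec_smul, map_smul_eq_mul] using this
  rw [le_div_iff₀ hc]
  have := apply_nonneg q (A.mulVec v)
  nlinarith

/-- For a norm on `ℝ^k`, `k ≥ 1`, the limit that defines the matrix measure exists. -/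
theorem tendsto_matrixMeasure {k : ℕ} (hk : 1 ≤ k) {p : Seminorm ℝ (Fin k → ℝ)} (hp : IsNorm p)
    (A : Matrix (Fin k) (Fin k) ℝ) :
    Tendsto (fun s : ℝ => (inducedNorm p p (1 + s • A) - 1) / s) (𝓝[>] 0)
      (𝓝 (matrixMeasure p A)) := by
  obtain ⟨e, he⟩ : ∃ e : Fin k → ℝ, p e = 1 := by
    let u : Fin k → ℝ := fun _ => 1
    have hu : p u ≠ 0 := fun h => by
      have := congrFun (hp u h) ⟨0, hk⟩
      simp [u] at this
    exact ⟨(p u)⁻¹ • u, by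
      rw [map_smul_eq_mul, norm_inv, Real.norm_of_nonneg (apply_nonneg p u), inv_mul_cancel₀ hu]⟩
  have hle : ∀ (B : Matrix (Fin k) (Fin k) ℝ) v, p v = 1 → p (B.mulVec v) ≤ inducedNorm p p B :=
    fun B v hv => le_csSup (bddAbove_inducedNorm hp p B) ⟨v, hv, rfl⟩
  have hge : ∀ (B : Matrix (Fin k) (Fin k) ℝ) c, (∀ v, p v = 1 → p (B.mulVec v) ≤ c) →
      inducedNorm p p B ≤ c := by
    intro B c h
    refine csSup_le ⟨_, e, he, rfl⟩ ?_
    rintro r ⟨v, hv, rfl⟩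
    exact h v hv
  have hmono : MonotoneOn (fun s : ℝ => (inducedNorm p p (1 + s • A) - 1) / s) (Ioi 0) := by
    intro s hs r hr hsr
    simp only [mem_Ioi] at hs hr
    have hsr1 : s / r ≤ 1 := (div_le_one hr).2 hsr
    have key : inducedNorm p p (1 + s • A) ≤
        (1 - s / r) + s / r * inducedNorm p p (1 + r • A) := by
      refine hge _ _ fun v hv => ?_
      have e1 : (1 + s • A).mulVec v =
          (1 - s / r) • v + (s / r) • (1 + r • A).mulVec v := by
        simp only [Matrix.add_mulVec, Matrix.one_mulVec, Matrix.smul_mulVec, smul_add, smul_smul]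
        rw [div_mul_cancel₀ _ hr.ne', sub_smul, one_smul]
        abel
      rw [e1]
      refine (map_add_le_add p _ _).trans ?_
      rw [map_smul_eq_mul, map_smul_eq_mul, Real.norm_of_nonneg (by linarith),
        Real.norm_of_nonneg (by positivity), hv, mul_one]
      have := hle (1 + r • A) v hv
      gcongr
    show _ / s ≤ _ / r
    rw [div_le_iff₀ hs]
    calc _ ≤ s / r * (inducedNorm p p (1 + r • A) - 1) := by linarith
      _ = _ := by ring
  have hbdd : BddBelow ((fun s : ℝ => (inducedNorm p p (1 + s • A) - 1) / s) '' Ioi 0) := by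
    refine ⟨-p (A.mulVec e), ?_⟩
    rintro _ ⟨s, hs, rfl⟩
    simp only [mem_Ioi] at hs
    have h1 := hle (1 + s • A) e he
    have h2 : p e ≤ p ((1 + s • A).mulVec e) + s * p (A.mulVec e) := by
      have e1 : e = (1 + s • A).mulVec e - s • A.mulVec e := by
        simp [Matrix.add_mulVec, Matrix.smul_mulVec]
      calc p e = p ((1 + s • A).mulVec e - s • A.mulVec e) := by rw [← e1]
        _ ≤ _ := map_sub_le_add p _ _
        _ = _ := by rw [map_smul_eq_mul, Real.norm_of_nonneg hs.le]
    show _ ≤ _ / s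
    rw [le_div_iff₀ hs]
    linarith
  exact tendsto_nhds_limUnder ⟨_, hmono.tendsto_nhdsGT hbdd⟩

/-! ### Time-varying systems and their solutions -/

/-- The state space `ℝ^{n_1} × ⋯ × ℝ^{n_m}`; its instance norm is only used for its topology,
for derivatives and for integrals. -/
abbrev State {m : ℕ} (n : Fin m → ℕ) : Type := (i : Fin m) → Fin (n i) → ℝ

/-- `g(t, x)`, `t ≥ t₀`, is piecewise continuous in `t` and continuous in `x`: there are times
`t₀ = τ_0 < τ_1 < ⋯` tending to infinity such that on each `(τ_k, τ_{k+1}) × X` the function `g`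
agrees with a function that is continuous on `[τ_k, τ_{k+1}] × X`. (The values of `g` at the
times `τ_k` are not restricted, and `τ_k` need not be a discontinuity.) -/
def PiecewiseContinuous {X Y : Type*} [TopologicalSpace X] [TopologicalSpace Y]
    (t₀ : ℝ) (g : ℝ → X → Y) : Prop :=
  ∃ τ : ℕ → ℝ, τ 0 = t₀ ∧ StrictMono τ ∧ Tendsto τ atTop atTop ∧
    ∀ k, ∃ G : ℝ × X → Y, ContinuousOn G (Icc (τ k) (τ (k + 1)) ×ˢ univ) ∧
      ∀ t ∈ Ioo (τ k) (τ (k + 1)), ∀ x, g t x = G (t, x)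

/-- Regularity of the right-hand side of `ẋ = f(t, x)`, `t ≥ t₀`: piecewise continuous in `t`,
continuously differentiable in `x`, with a Jacobian that is bounded on bounded time intervals and
compact sets of states (as is the case when the Jacobian is piecewise continuous in `t` too; this
is what makes solutions unique). -/
structure IsRegular {X : Type*} [NormedAddCommGroup X] [NormedSpace ℝ X]
    (t₀ : ℝ) (f : ℝ → X → X) : Prop where
  piecewise : PiecewiseContinuous t₀ f
  contDiff : ∀ t, t₀ ≤ t → ContDiff ℝ 1 (f t)
  bounded_fderiv : ∀ (t₁ : ℝ) (C : Set X), IsCompact C →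
    ∃ L : ℝ, ∀ t ∈ Icc t₀ t₁, ∀ x ∈ C, ‖fderiv ℝ (f t) x‖ ≤ L

/-- `φ` is a solution of `ẋ = f(t, x)`, `t ≥ t₀`, with `φ(t₀) = x` (in integral form, that is, `φ`
is locally absolutely continuous and satisfies the equation almost everywhere). -/
def IsSolution {X : Type*} [NormedAddCommGroup X] [NormedSpace ℝ X]
    (f : ℝ → X → X) (t₀ : ℝ) (x : X) (φ : ℝ → X) : Prop :=
  ContinuousOn φ (Ici t₀) ∧
    ∀ t, t₀ ≤ t → IntervalIntegrable (fun s => f s (φ s)) MeasureTheory.volume t₀ t ∧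
      φ t = x + ∫ s in t₀..t, f s (φ s)

/-- Every initial state at time `t₀` has a solution on the whole of `[t₀, ∞)`. -/
def IsForwardComplete {X : Type*} [NormedAddCommGroup X] [NormedSpace ℝ X]
    (f : ℝ → X → X) (t₀ : ℝ) : Prop :=
  ∀ x, ∃ φ, IsSolution f t₀ x φ

open Classical in
/-- The solution `ξ(t, t₀, x)` at time `t` with initial state `x` at time `t₀`. -/
def flow {X : Type*} [NormedAddCommGroup X] [NormedSpace ℝ X]
    (f : ℝ → X → X) (t t₀ : ℝ) (x : X) : X :=
  if h : ∃ φ, IsSolution f t₀ x φ then h.choose t else x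

/-- The reachable set `ξ(t, t₀, K)`. -/
def reachableSet {X : Type*} [NormedAddCommGroup X] [NormedSpace ℝ X]
    (f : ℝ → X → X) (t t₀ : ℝ) (K : Set X) : Set X :=
  (fun x => flow f t t₀ x) '' K

/-! ### Topological entropy -/

section Entropy

variable {X : Type*} [NormedAddCommGroup X] [NormedSpace ℝ X]

/-- `E ⊆ K` is `(T, ε)`-spanning for `K` at initial time `t₀`, with respect to the norm `p`. -/
def IsSpanning (p : Seminorm ℝ X) (f : ℝ → X → X) (t₀ ε T : ℝ) (K : Set X)
    (E : Finset X) : Prop :=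
  (E : Set X) ⊆ K ∧
    ∀ y ∈ K, ∃ x ∈ E, ∀ t ∈ Icc t₀ (t₀ + T), p (flow f t t₀ y - flow f t t₀ x) < ε

/-- The minimal cardinality `S(f, t₀, ε, T, K)` of a `(T, ε)`-spanning set. -/
def spanNumber (p : Seminorm ℝ X) (f : ℝ → X → X) (t₀ ε T : ℝ) (K : Set X) : ℕ∞ :=
  ⨅ (E : Finset X) (_ : IsSpanning p f t₀ ε T K E), (E.card : ℕ∞)

/-- `limsup_{T → ∞} (1 / T) log S(f, t₀, ε, T, K)`. -/
def spanGrowth (p : Seminorm ℝ X) (f : ℝ → X → X) (t₀ ε : ℝ) (K : Set X) : EReal :=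
  limsup (fun T : ℝ => ENNReal.log (spanNumber p f t₀ ε T K : ENNReal) / (T : EReal)) atTop

/-- The topological entropy `h(f, t₀, K)`: the limit of `spanGrowth` as `ε ↘ 0`, which is its
supremum over `ε > 0` as it is nonincreasing in `ε` (see `tendsto_spanGrowth`). -/
def entropy (p : Seminorm ℝ X) (f : ℝ → X → X) (t₀ : ℝ) (K : Set X) : EReal :=
  ⨆ (ε : ℝ) (_ : 0 < ε), spanGrowth p f t₀ ε K

theorem spanGrowth_antitone (p : Seminorm ℝ X) (f : ℝ → X → X) (t₀ : ℝ) (K : Set X) :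
    Antitone fun ε => spanGrowth p f t₀ ε K := by
  intro a b hab
  refine limsup_le_limsup ?_
  filter_upwards [eventually_gt_atTop (0 : ℝ)] with T hT
  refine EReal.div_le_div_right_of_nonneg (by exact_mod_cast hT.le) ?_
  refine ENNReal.log_monotone ?_
  have : spanNumber p f t₀ b T K ≤ spanNumber p f t₀ a T K := by
    refine le_iInf₂ fun E hE => iInf₂_le E ⟨hE.1, fun y hy => ?_⟩
    obtain ⟨x, hx, h⟩ := hE.2 y hy
    exact ⟨x, hx, fun t ht => (h t ht).trans_le hab⟩
  exact_mod_cast this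

theorem tendsto_spanGrowth (p : Seminorm ℝ X) (f : ℝ → X → X) (t₀ : ℝ) (K : Set X) :
    Tendsto (fun ε => spanGrowth p f t₀ ε K) (𝓝[>] 0) (𝓝 (entropy p f t₀ K)) := by
  have h := (spanGrowth_antitone p f t₀ K).tendsto_nhdsGT 0
  rw [sSup_image] at h
  exact h

end Entropy

/-! ### The interconnection matrix function -/

/-- The Jacobian matrix of `f_i(t, x)` with respect to `x_j`, evaluated at `x = v`. -/
def jacobianBlock {m : ℕ} {n : Fin m → ℕ} (f : ℝ → State n → State n) (t : ℝ) (v : State n)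
    (i j : Fin m) : Matrix (Fin (n i)) (Fin (n j)) ℝ :=
  Matrix.of fun a b => fderiv ℝ (f t) v (Pi.single j (Pi.single b 1)) i a

/-- The interconnection matrix `A_N(t, v)` for the local norms `pL i` on `ℝ^{n_i}`: matrix
measures of the diagonal Jacobian blocks, induced norms of the off-diagonal ones. -/
def interMatrix {m : ℕ} {n : Fin m → ℕ} (pL : (i : Fin m) → Seminorm ℝ (Fin (n i) → ℝ))
    (f : ℝ → State n → State n) (t : ℝ) (v : State n) : Matrix (Fin m) (Fin m) ℝ :=
  Matrix.of fun i j =>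
    if i = j then matrixMeasure (pL i) (jacobianBlock f t v i i)
    else inducedNorm (pL j) (pL i) (jacobianBlock f t v i j)

/-- The constant `limsup_{t → ∞} max_{v ∈ co(ξ(t, t₀, K))} μ_N(A_N(t, v))`, an extended real
number. -/
def muHat {m : ℕ} {n : Fin m → ℕ} (pL : (i : Fin m) → Seminorm ℝ (Fin (n i) → ℝ))
    (pN : Seminorm ℝ (Fin m → ℝ)) (f : ℝ → State n → State n) (t₀ : ℝ)
    (K : Set (State n)) : EReal :=
  limsup (fun t : ℝ => ⨆ v ∈ convexHull ℝ (reachableSet f t t₀ K),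
    ((matrixMeasure pN (interMatrix pL f t v) : ℝ) : EReal)) atTop

end InterEntropy

end

noncomputable section

namespace InterEntropy

/-! ### Directional derivatives of seminorms -/

section DirDeriv

variable {X : Type*} [AddCommGroup X] [Module ℝ X]

/-! Measure the state by the network norm `q x = |(|x_1|_1, …, |x_m|_m)|_N` of `networkSeminorm`.
For two solutions with difference `δ`, the right derivative of `q δ` is the directional derivative
of `q` at `δ` along `f(t, φ) - f(t, ψ)`. Neither `q` nor the flow has to be differentiable:
`dirDeriv` exists by convexity. It is also sublinear, so Hahn–Banach supplies a linear functional
that reduces the increment of `f` to a scalar mean value theorem (`dirDeriv_image_sub_le`). It then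
suffices to bound the derivative along `J(v) δ` for `v` on the segment joining the two solutions,
which lies in the convex hull of the reachable set.

The bound there is `μ_N(A_N(t, v)) q δ`. In `q (δ + s J δ)` the diagonal blocks enter through `‖I +
s J_ii‖` and the others through their induced norms. Monotonicity of the outer norm passes these
blockwise bounds to `I + s A_N`, up to an error `o(s)` (`dirDeriv_networkSeminorm_le`).

Hence for any real `c > max(μ̂_N, 0)`, Grönwall's inequality gives growth at rate at most `c` after
some finite time. Before that time the flow is Lipschitz in the initial state, because solutions
from `K` stay in a ball on which the Jacobian is bounded. A cover of `K` by balls of radius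
proportional to `exp(-cT)` is therefore spanning and needs at most a constant times `exp(NcT)`
balls, where `N = ∑ n_i` (`spanGrowth_le`). Finally `c` decreases to `max(μ̂_N, 0)`. -/

/-- The right directional derivative of the seminorm `q` at `x` in the direction `w`. -/
def dirDeriv (q : Seminorm ℝ X) (x w : X) : ℝ :=
  sInf ((fun s : ℝ => (q (x + s • w) - q x) / s) '' Ioi 0)

theorem monotoneOn_seminorm_slope (q : Seminorm ℝ X) (x w : X) :
    MonotoneOn (fun s : ℝ => (q (x + s • w) - q x) / s) (Ioi 0) := by
  intro s hs r hr hsr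
  simp only [mem_Ioi] at hs hr
  have hsr1 : s / r ≤ 1 := (div_le_one hr).2 hsr
  have e1 : x + s • w = (1 - s / r) • x + (s / r) • (x + r • w) := by
    rw [smul_add, smul_smul, div_mul_cancel₀ _ hr.ne', sub_smul, one_smul]
    abel
  have key : q (x + s • w) ≤ (1 - s / r) * q x + s / r * q (x + r • w) := by
    rw [e1]
    refine (map_add_le_add q _ _).trans ?_
    rw [map_smul_eq_mul, map_smul_eq_mul, Real.norm_of_nonneg (by linarith),
      Real.norm_of_nonneg (by positivity)]
  show _ / s ≤ _ / r
  rw [div_le_iff₀ hs]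
  calc _ ≤ s / r * (q (x + r • w) - q x) := by linarith
    _ = _ := by ring

theorem tendsto_dirDeriv (q : Seminorm ℝ X) (x w : X) :
    Tendsto (fun s : ℝ => (q (x + s • w) - q x) / s) (𝓝[>] 0) (𝓝 (dirDeriv q x w)) := by
  refine (monotoneOn_seminorm_slope q x w).tendsto_nhdsGT ⟨-q w, ?_⟩
  rintro _ ⟨s, hs, rfl⟩
  simp only [mem_Ioi] at hs
  show _ ≤ _ / s
  rw [le_div_iff₀ hs]
  have h : q x ≤ q (x + s • w) + s * q w := by
    calc q x = q ((x + s • w) - s • w) := by rw [add_sub_cancel_right]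
      _ ≤ _ := map_sub_le_add q _ _
      _ = _ := by rw [map_smul_eq_mul, Real.norm_of_nonneg hs.le]
  linarith

theorem dirDeriv_smul (q : Seminorm ℝ X) (x w : X) {c : ℝ} (hc : 0 < c) :
    dirDeriv q x (c • w) = c * dirDeriv q x w := by
  refine tendsto_nhds_unique (tendsto_dirDeriv q x (c • w)) ?_
  have h1 : Tendsto (fun s : ℝ => s * c) (𝓝[>] 0) (𝓝[>] 0) := by
    refine tendsto_nhdsWithin_iff.2 ⟨?_, ?_⟩
    · have : Tendsto (fun s : ℝ => s * c) (𝓝 0) (𝓝 (0 * c)) := tendsto_id.mul_const c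
      rw [zero_mul] at this
      exact this.mono_left nhdsWithin_le_nhds
    · filter_upwards [self_mem_nhdsWithin] with s hs
      exact mul_pos hs hc
  refine (((tendsto_dirDeriv q x w).comp h1).const_mul c).congr' ?_
  filter_upwards [self_mem_nhdsWithin] with s hs
  have hs : s ≠ 0 := (mem_Ioi.1 hs).ne'
  simp only [Function.comp, smul_smul]
  field_simp

/-- Convexity of `q`: a step `s` along `w + w'` is the midpoint of steps `2s` along `w` and along
`w'`. -/
theorem dirDeriv_add_le (q : Seminorm ℝ X) (x w w' : X) :
    dirDeriv q x (w + w') ≤ dirDeriv q x w + dirDeriv q x w' := by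
  have h1 : Tendsto (fun s : ℝ => 2 * s) (𝓝[>] 0) (𝓝[>] 0) := by
    refine tendsto_nhdsWithin_iff.2 ⟨?_, ?_⟩
    · have : Tendsto (fun s : ℝ => 2 * s) (𝓝 0) (𝓝 (2 * 0)) := tendsto_id.const_mul 2
      rw [mul_zero] at this
      exact this.mono_left nhdsWithin_le_nhds
    · filter_upwards [self_mem_nhdsWithin] with s hs
      exact mul_pos two_pos (mem_Ioi.1 hs)
  refine le_of_tendsto_of_tendsto (tendsto_dirDeriv q x (w + w'))
    (((tendsto_dirDeriv q x w).comp h1).add ((tendsto_dirDeriv q x w').comp h1)) ?_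
  filter_upwards [self_mem_nhdsWithin] with s hs
  have hs : 0 < s := hs
  have e : x + s • (w + w') =
      (1 / 2 : ℝ) • (x + (2 * s) • w) + (1 / 2 : ℝ) • (x + (2 * s) • w') := by
    module
  have h : q (x + s • (w + w')) ≤ 1 / 2 * q (x + (2 * s) • w) + 1 / 2 * q (x + (2 * s) • w') := by
    rw [e]
    refine (map_add_le_add q _ _).trans ?_
    rw [map_smul_eq_mul, map_smul_eq_mul, Real.norm_of_nonneg (by norm_num)]
  simp only [Function.comp]
  rw [← add_div, div_le_div_iff₀ hs (by positivity)]
  nlinarith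

theorem dirDeriv_zero (q : Seminorm ℝ X) (x : X) : dirDeriv q x 0 = 0 := by
  -- Homogeneity with factor `2` forces the value to equal its own double.
  have := dirDeriv_smul q x 0 (c := 2) two_pos
  rw [smul_zero] at this
  linarith

theorem dirDeriv_le (q : Seminorm ℝ X) (x w : X) : dirDeriv q x w ≤ q w := by
  refine le_of_tendsto (tendsto_dirDeriv q x w) ?_
  filter_upwards [self_mem_nhdsWithin] with s hs
  have hs : 0 < s := hs
  rw [div_le_iff₀ hs]
  have := map_add_le_add q x (s • w)
  rw [map_smul_eq_mul, Real.norm_of_nonneg hs.le] at this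
  linarith

/-- The directional derivative is attained by a linear functional that it dominates. -/
theorem exists_linearMap_le_dirDeriv (q : Seminorm ℝ X) (x w : X) :
    ∃ l : X →ₗ[ℝ] ℝ, l w = dirDeriv q x w ∧ ∀ v, l v ≤ dirDeriv q x v := by
  by_cases hw : w = 0
  · obtain ⟨l, -, hl⟩ := exists_extension_of_le_sublinear (⊥ : X →ₗ.[ℝ] ℝ) (dirDeriv q x)
      (fun c hc v => dirDeriv_smul q x v hc) (dirDeriv_add_le q x) (by
        rintro ⟨v, hv⟩
        have hv : v = 0 := (Submodule.mem_bot ℝ).1 hv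
        subst hv
        exact (dirDeriv_zero q x).ge)
    exact ⟨l, by rw [hw, map_zero, dirDeriv_zero], hl⟩
  · obtain ⟨l, hl, hl'⟩ := exists_extension_of_le_sublinear
      (LinearPMap.mkSpanSingleton (σ := RingHom.id ℝ) w (dirDeriv q x w) hw) (dirDeriv q x)
      (fun c hc v => dirDeriv_smul q x v hc) (dirDeriv_add_le q x) (by
        rintro ⟨v, hv⟩
        obtain ⟨c, rfl⟩ := Submodule.mem_span_singleton.1 hv
        refine (LinearPMap.mkSpanSingleton'_apply w _ _ c hv).trans_le ?_
        simp only [RingHom.id_apply, smul_eq_mul]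
        rcases lt_trichotomy c 0 with hc | rfl | hc
        -- For negative multiples, subadditivity gives `0 ≤ d(w) + d(-w)`, hence `c d(w) ≤ -c d(-w)
        -- = d(c w)`.
        · have h1 := dirDeriv_smul q x (c • w) (neg_pos.2 (inv_lt_zero.2 hc))
          have h2 := dirDeriv_add_le q x w (-w)
          have h3 := dirDeriv_smul q x (-w) (neg_pos.2 hc)
          rw [add_neg_cancel, dirDeriv_zero] at h2
          rw [neg_smul_neg] at h3
          rw [h3]
          nlinarith
        · simp [dirDeriv_zero]
        · exact (dirDeriv_smul q x w hc).ge)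
    refine ⟨l, ?_, hl'⟩
    rw [hl ⟨w, Submodule.mem_span_singleton_self w⟩]
    exact LinearPMap.mkSpanSingleton_apply ℝ ℝ hw _

end DirDeriv

/-- A mean value inequality for the directional derivative of a seminorm. -/
theorem dirDeriv_image_sub_le {X : Type*} [NormedAddCommGroup X] [NormedSpace ℝ X]
    [FiniteDimensional ℝ X] (q : Seminorm ℝ X) {F : X → X} (hF : Differentiable ℝ F) (x y : X)
    {C : ℝ} (h : ∀ v ∈ segment ℝ x y, dirDeriv q (y - x) (fderiv ℝ F v (y - x)) ≤ C) :
    dirDeriv q (y - x) (F y - F x) ≤ C := by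
  -- Equality is needed only at the increment of `F`; at the intermediate point of the mean value
  -- theorem, domination is enough.
  obtain ⟨l, hl, hle⟩ := exists_linearMap_le_dirDeriv q (y - x) (F y - F x)
  let l' : X →L[ℝ] ℝ := LinearMap.toContinuousLinearMap l
  obtain ⟨z, hz, e⟩ := domain_mvt (f := fun v => l' (F v)) (s := univ) (x := x) (y := y)
    (f' := fun v => l'.comp (fderiv ℝ F v))
    (fun v _ => (l'.hasFDerivAt.comp v (hF v).hasFDerivAt).hasFDerivWithinAt) convex_univ
    (mem_univ _) (mem_univ _)
  rw [← hl]
  calc l (F y - F x) = l' (F y) - l' (F x) := map_sub l _ _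
    _ = l (fderiv ℝ F z (y - x)) := e
    _ ≤ _ := hle _
    _ ≤ C := h z hz

/-! ### Comparison of solutions -/

section Compare

variable {X : Type*} [NormedAddCommGroup X] [NormedSpace ℝ X]

/-- Replacing `δ` by its first-order expansion costs `o(z - t)` in `q`, so the right difference
quotients of `q ∘ δ` are asymptotically bounded by `dirDeriv q (δ t) (w t)`, and Grönwall's
inequality applies. -/
theorem seminorm_le_exp_of_dirDeriv_le_aux {q : Seminorm ℝ X} (hq : Continuous q) {δ w : ℝ → X}
    {a b c : ℝ} (hab : a ≤ b) (hd : ∀ t ∈ Icc a b, HasDerivAt δ (w t) t)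
    (h : ∀ t ∈ Icc a b, dirDeriv q (δ t) (w t) ≤ c * q (δ t)) :
    q (δ b) ≤ q (δ a) * Real.exp (c * (b - a)) := by
  obtain ⟨C, hC, hqC⟩ := Seminorm.bound_of_continuous_normedSpace q hq
  have hcont : ContinuousOn (fun t => q (δ t)) (Icc a b) := fun t ht =>
    (hq.continuousAt.comp (hd t ht).continuousAt).continuousWithinAt
  have := le_gronwallBound_of_liminf_deriv_right_le (f' := fun t => c * q (δ t)) (K := c) (ε := 0)
    (δ := q (δ a)) hcont ?_ le_rfl (fun t _ => by simp) b ⟨hab, le_rfl⟩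
  · rwa [gronwallBound_ε0] at this
  intro t ht r hr
  have ht : t ∈ Icc a b := ⟨ht.1, ht.2.le⟩
  have h1 : Tendsto (fun z : ℝ => z - t) (𝓝[>] t) (𝓝[>] 0) := by
    refine tendsto_nhdsWithin_iff.2 ⟨?_, ?_⟩
    · have : Tendsto (fun z : ℝ => z - t) (𝓝 t) (𝓝 (t - t)) := tendsto_id.sub_const t
      rw [sub_self] at this
      exact this.mono_left nhdsWithin_le_nhds
    · filter_upwards [self_mem_nhdsWithin] with z hz
      exact sub_pos.2 (mem_Ioi.1 hz)
  have h2 := (tendsto_dirDeriv q (δ t) (w t)).comp h1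
  have h3 : Tendsto (fun z => C * ‖(z - t)⁻¹ • (δ z - δ t) - w t‖) (𝓝[>] t) (𝓝 0) := by
    have := (hasDerivAt_iff_tendsto_slope.1 (hd t ht)).mono_left
      (nhdsWithin_mono t (fun z hz => (mem_Ioi.1 hz).ne') : 𝓝[>] t ≤ 𝓝[≠] t)
    have := ((this.sub_const (w t)).norm).const_mul C
    simpa [slope_def_module] using this
  have h4 := h2.add h3
  rw [add_zero] at h4
  have h5 : ∀ᶠ z in 𝓝[>] t, _ := h4.eventually (gt_mem_nhds ((h t ht).trans_lt hr))
  refine Eventually.frequently ?_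
  filter_upwards [h5, self_mem_nhdsWithin] with z hz hzt
  have hzt : 0 < z - t := sub_pos.2 hzt
  refine lt_of_le_of_lt ?_ hz
  simp only [Function.comp]
  have e : δ z = (δ t + (z - t) • w t) + (z - t) • ((z - t)⁻¹ • (δ z - δ t) - w t) := by
    rw [smul_sub, smul_smul, mul_inv_cancel₀ hzt.ne', one_smul]
    abel
  have h6 : q (δ z) ≤ q (δ t + (z - t) • w t) +
      (z - t) * (C * ‖(z - t)⁻¹ • (δ z - δ t) - w t‖) := by
    conv_lhs => rw [e]
    refine (map_add_le_add q _ _).trans ?_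
    rw [map_smul_eq_mul, Real.norm_of_nonneg hzt.le]
    gcongr
    exact hqC _
  rw [inv_mul_le_iff₀ hzt, mul_add, mul_div_cancel₀ _ hzt.ne']
  linarith

/-- A differential inequality for a seminorm along a curve gives exponential growth. -/
theorem seminorm_le_exp_of_dirDeriv_le {q : Seminorm ℝ X} (hq : Continuous q) {δ w : ℝ → X}
    {a b c : ℝ} (hab : a ≤ b) (hδ : ContinuousOn δ (Icc a b))
    (hd : ∀ t ∈ Ioo a b, HasDerivAt δ (w t) t)
    (h : ∀ t ∈ Ioo a b, dirDeriv q (δ t) (w t) ≤ c * q (δ t)) :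
    q (δ b) ≤ q (δ a) * Real.exp (c * (b - a)) := by
  rcases hab.eq_or_lt with rfl | hab
  · simp
  have hc : ContinuousOn (fun t => q (δ t)) (Icc a b) := hq.comp_continuousOn hδ
  have hcl : closure (Ioo a b) = Icc a b := closure_Ioo hab.ne
  -- Derivatives are known only in the open interval: the estimate is proved inside, then extended
  -- by continuity to the right endpoint and afterwards to the left one.
  have key : ∀ s ∈ Ioo a b, ∀ t ∈ Ioo a b, s ≤ t → q (δ t) ≤ q (δ s) * Real.exp (c * (t - s)) :=
    fun s hs t ht hst => seminorm_le_exp_of_dirDeriv_le_aux hq hst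
      (fun r hr => hd r ⟨hs.1.trans_le hr.1, hr.2.trans_lt ht.2⟩)
      (fun r hr => h r ⟨hs.1.trans_le hr.1, hr.2.trans_lt ht.2⟩)
  have key2 : ∀ s ∈ Ioo a b, q (δ b) ≤ q (δ s) * Real.exp (c * (b - s)) := by
    intro s hs
    have hb : b ∈ closure (Ioo s b) := by
      rw [closure_Ioo hs.2.ne]; exact ⟨hs.2.le, le_rfl⟩
    have hsub : Ioo s b ⊆ Icc a b := fun r hr => ⟨(hs.1.trans hr.1).le, hr.2.le⟩
    refine ContinuousWithinAt.closure_le (f := fun t => q (δ t))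
      (g := fun t => q (δ s) * Real.exp (c * (t - s))) hb
      ((hc b ⟨hab.le, le_rfl⟩).mono hsub) (by fun_prop) fun t ht => ?_
    exact key s hs t ⟨hs.1.trans ht.1, ht.2⟩ ht.1.le
  have ha : a ∈ closure (Ioo a b) := by rw [hcl]; exact ⟨le_rfl, hab.le⟩
  exact ContinuousWithinAt.closure_le (f := fun _ => q (δ b))
    (g := fun t => q (δ t) * Real.exp (c * (b - t))) ha continuousWithinAt_const
    (((hc a ⟨le_rfl, hab.le⟩).mono Ioo_subset_Icc_self).mul (by fun_prop)) key2

variable {f : ℝ → X → X} {t₀ : ℝ}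

/-- Between breakpoints the integrand is continuous, so the integral equation can be differentiated.
-/
theorem IsSolution.hasDerivAt [CompleteSpace X] {x : X} {φ : ℝ → X} (hφ : IsSolution f t₀ x φ)
    {a b : ℝ} (ha : t₀ ≤ a) {G : ℝ × X → X} (hG : ContinuousOn G (Icc a b ×ˢ univ))
    (hfG : ∀ t ∈ Ioo a b, ∀ x, f t x = G (t, x)) {t : ℝ} (ht : t ∈ Ioo a b) :
    HasDerivAt φ (f t (φ t)) t := by
  have hcon : ContinuousOn (fun s => f s (φ s)) (Ioo a b) := by
    have h1 : ContinuousOn (fun s => G (s, φ s)) (Ioo a b) := by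
      refine hG.comp (continuousOn_id.prodMk (hφ.1.mono fun s hs => ?_)) fun s hs => ?_
      · exact ha.trans hs.1.le
      · exact ⟨Ioo_subset_Icc_self hs, mem_univ _⟩
    exact h1.congr fun s hs => hfG s hs _
  have hI := intervalIntegral.integral_hasDerivAt_right (hφ.2 t (ha.trans ht.1.le)).1
    (hcon.stronglyMeasurableAtFilter isOpen_Ioo t ht) (hcon.continuousAt (isOpen_Ioo.mem_nhds ht))
  refine (hI.const_add x).congr_of_eventuallyEq ?_
  filter_upwards [isOpen_Ioo.mem_nhds ht] with s hs
  exact (hφ.2 s (ha.trans hs.1.le)).2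

theorem IsSolution.map_initial {x : X} {φ : ℝ → X} (hφ : IsSolution f t₀ x φ) : φ t₀ = x := by
  simpa using (hφ.2 t₀ le_rfl).2

/-- Comparison of two solutions in terms of a one-sided Lipschitz condition along them. -/
theorem IsSolution.seminorm_sub_le [CompleteSpace X] (hpc : PiecewiseContinuous t₀ f) {x y : X}
    {φ ψ : ℝ → X} (hφ : IsSolution f t₀ x φ) (hψ : IsSolution f t₀ y ψ)
    {q : Seminorm ℝ X} (hq : Continuous q) {a b c : ℝ} (ha : t₀ ≤ a) (hab : a ≤ b)
    (h : ∀ t ∈ Ioo a b,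
      dirDeriv q (φ t - ψ t) (f t (φ t) - f t (ψ t)) ≤ c * q (φ t - ψ t)) :
    q (φ b - ψ b) ≤ q (φ a - ψ a) * Real.exp (c * (b - a)) := by
  obtain ⟨τ, hτ0, hτm, hτ, hG⟩ := hpc
  have hτ0' : ∀ k, t₀ ≤ τ k := fun k => hτ0 ▸ hτm.monotone (Nat.zero_le k)
  have hcont : ContinuousOn (fun t => φ t - ψ t) (Ici t₀) := hφ.1.sub hψ.1
  -- Induction over breakpoints: each step crosses one continuity piece, starting from the later of
  -- `a` and `τ k`, and the exponential factors multiply.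
  have key : ∀ k, ∀ t ∈ Icc a b, t ≤ τ k →
      q (φ t - ψ t) ≤ q (φ a - ψ a) * Real.exp (c * (t - a)) := by
    intro k
    induction k with
    | zero =>
      intro t ht htk
      have : t = a := le_antisymm (by linarith) ht.1
      simp [this]
    | succ k ih =>
      intro t ht htk
      rcases le_or_gt t (τ k) with htk' | htk'
      · exact ih t ht htk'
      have hs : q (φ (max a (τ k)) - ψ (max a (τ k))) ≤
          q (φ a - ψ a) * Real.exp (c * (max a (τ k) - a)) := by
        rcases le_total a (τ k) with hak | hak
        · rw [max_eq_right hak]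
          exact ih _ ⟨hak, htk'.le.trans ht.2⟩ le_rfl
        · simp [max_eq_left hak]
      set s := max a (τ k)
      have hst : s ≤ t := max_le ht.1 htk'.le
      have has : a ≤ s := le_max_left _ _
      have hks : τ k ≤ s := le_max_right _ _
      obtain ⟨G, hG, hfG⟩ := hG k
      have hsub : ∀ r ∈ Ioo s t, r ∈ Ioo (τ k) (τ (k + 1)) := fun r hr =>
        ⟨hks.trans_lt hr.1, hr.2.trans_le htk⟩
      have h1 := seminorm_le_exp_of_dirDeriv_le (δ := fun t => φ t - ψ t)
        (w := fun t => f t (φ t) - f t (ψ t)) (c := c) hq hst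
        (hcont.mono fun r hr => ha.trans (has.trans hr.1))
        (fun r hr => (hφ.hasDerivAt (hτ0' k) hG hfG (hsub r hr)).sub
          (hψ.hasDerivAt (hτ0' k) hG hfG (hsub r hr)))
        (fun r hr => h r ⟨has.trans_lt hr.1, hr.2.trans_le ht.2⟩)
      calc _ ≤ q (φ s - ψ s) * Real.exp (c * (t - s)) := h1
        _ ≤ q (φ a - ψ a) * Real.exp (c * (s - a)) * Real.exp (c * (t - s)) := by gcongr
        _ = _ := by rw [mul_assoc, ← Real.exp_add]; ring_nf
  obtain ⟨k, hk⟩ := (hτ.eventually_ge_atTop b).exists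
  exact key k b ⟨hab, le_rfl⟩ hk

/-- Solutions are Lipschitz in the initial state on a compact convex tube. -/
theorem IsSolution.norm_sub_le [CompleteSpace X] (hf : IsRegular t₀ f) {x y : X}
    {φ ψ : ℝ → X} (hφ : IsSolution f t₀ x φ) (hψ : IsSolution f t₀ y ψ) {b L : ℝ} (hb : t₀ ≤ b)
    (h : ∀ t ∈ Ioo t₀ b, ∃ s : Set X, Convex ℝ s ∧ φ t ∈ s ∧ ψ t ∈ s ∧
      ∀ v ∈ s, ‖fderiv ℝ (f t) v‖ ≤ L) :
    ‖φ b - ψ b‖ ≤ ‖x - y‖ * Real.exp (L * (b - t₀)) := by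
  have := hφ.seminorm_sub_le hf.piecewise hψ (q := normSeminorm ℝ X) (c := L) continuous_norm le_rfl hb
    fun t ht => by
      obtain ⟨s, hs, h1, h2, h3⟩ := h t ht
      refine (dirDeriv_le _ _ _).trans ?_
      exact hs.norm_image_sub_le_of_norm_fderiv_le
        (fun v _ => ((hf.contDiff t ht.1.le).differentiable (by norm_num)) v) h3 h2 h1
  rwa [hφ.map_initial, hψ.map_initial] at this

/-- Solutions that start close to a given one stay close to it on a bounded time interval. -/
theorem IsSolution.exists_forall_norm_sub_le_one [ProperSpace X] (hf : IsRegular t₀ f) {x : X}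
    {φ : ℝ → X} (hφ : IsSolution f t₀ x φ) (T : ℝ) :
    ∃ ρ > 0, ∀ y ψ, IsSolution f t₀ y ψ → ‖y - x‖ < ρ → ∀ t ∈ Icc t₀ T, ‖ψ t - φ t‖ ≤ 1 := by
  have hC : IsCompact (Metric.cthickening 1 (φ '' Icc t₀ T)) :=
    (isCompact_Icc.image_of_continuousOn (hφ.1.mono fun s hs => hs.1)).cthickening
  obtain ⟨L', hL'⟩ := hf.bounded_fderiv T _ hC
  obtain ⟨L, hL0, hL⟩ : ∃ L : ℝ, 0 ≤ L ∧ ∀ t ∈ Icc t₀ T,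
      ∀ v ∈ Metric.cthickening 1 (φ '' Icc t₀ T), ‖fderiv ℝ (f t) v‖ ≤ L :=
    ⟨max L' 0, le_max_right _ _, fun t ht v hv => (hL' t ht v hv).trans (le_max_left _ _)⟩
  -- This radius cancels the largest possible growth up to time `T`.
  refine ⟨Real.exp (-(L * (T - t₀))), Real.exp_pos _, fun y ψ hψ hyx t ht => ?_⟩
  by_contra! hlt
  have hcont : ContinuousOn (fun s => ‖ψ s - φ s‖) (Icc t₀ t) :=
    ((hψ.1.sub hφ.1).mono fun s hs => hs.1).norm
  -- The least element of `S` is the first time at distance `1`. Until then the solution is in the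
  -- tube where `L` is valid, so the distance at that time is still below `1`, a contradiction.
  let S : Set ℝ := Icc t₀ t ∩ (fun s => ‖ψ s - φ s‖) ⁻¹' Ici 1
  have hSc : IsCompact S :=
    isCompact_Icc.of_isClosed_subset (hcont.preimage_isClosed_of_isClosed isClosed_Icc isClosed_Ici)
      inter_subset_left
  obtain ⟨s, ⟨hs, hs1⟩, hmin⟩ := hSc.exists_isLeast ⟨t, ⟨ht.1, le_rfl⟩, hlt.le⟩
  have hs1 : 1 ≤ ‖ψ s - φ s‖ := hs1
  have hlt1 : ∀ r ∈ Ioo t₀ s, ‖ψ r - φ r‖ < 1 := by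
    intro r hr
    by_contra! h
    exact absurd (hmin ⟨⟨hr.1.le, hr.2.le.trans hs.2⟩, h⟩) (not_le.2 hr.2)
  have hbd := hψ.norm_sub_le hf hφ (L := L) hs.1 fun r hr => by
    have hrT : r ∈ Icc t₀ T := ⟨hr.1.le, hr.2.le.trans (hs.2.trans ht.2)⟩
    refine ⟨Metric.closedBall (φ r) 1, convex_closedBall _ _, ?_, ?_, fun v hv => hL r hrT v ?_⟩
    · rw [mem_closedBall_iff_norm]; exact (hlt1 r hr).le
    · simp
    · exact Metric.closedBall_subset_cthickening (mem_image_of_mem φ hrT) 1 hv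
  have : ‖y - x‖ * Real.exp (L * (s - t₀)) < 1 := by
    calc _ ≤ ‖y - x‖ * Real.exp (L * (T - t₀)) := by
          gcongr
          exact hs.2.trans ht.2
      _ < Real.exp (-(L * (T - t₀))) * Real.exp (L * (T - t₀)) := by gcongr
      _ = 1 := by rw [← Real.exp_add, neg_add_cancel, Real.exp_zero]
  linarith

theorem isSolution_flow (hfc : IsForwardComplete f t₀) (x : X) :
    IsSolution f t₀ x (fun t => flow f t t₀ x) := by
  have h := hfc x
  have : (fun t => flow f t t₀ x) = h.choose := by
    funext t
    simp [flow, h]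
  rw [this]
  exact h.choose_spec

/-- The solutions that start in a compact set are uniformly bounded on bounded time intervals. -/
theorem exists_norm_flow_le [ProperSpace X] (hf : IsRegular t₀ f) (hfc : IsForwardComplete f t₀)
    {K : Set X} (hK : IsCompact K) (T : ℝ) :
    ∃ R : ℝ, ∀ x ∈ K, ∀ t ∈ Icc t₀ T, ‖flow f t t₀ x‖ ≤ R := by
  -- Boundedness is inherited by subsets and unions, so by compactness a neighbourhood of each
  -- initial state suffices.
  refine hK.induction_on (p := fun s => ∃ R : ℝ, ∀ x ∈ s, ∀ t ∈ Icc t₀ T, ‖flow f t t₀ x‖ ≤ R)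
    ⟨0, by simp⟩ (fun s u hsu ⟨R, hR⟩ => ⟨R, fun x hx => hR x (hsu hx)⟩) ?_ ?_
  · rintro s u ⟨R, hR⟩ ⟨R', hR'⟩
    refine ⟨max R R', ?_⟩
    rintro x (hx | hx) t ht
    · exact (hR x hx t ht).trans (le_max_left _ _)
    · exact (hR' x hx t ht).trans (le_max_right _ _)
  · intro x _
    obtain ⟨ρ, hρ, h⟩ := (isSolution_flow hfc x).exists_forall_norm_sub_le_one hf T
    obtain ⟨R, hR⟩ := (isCompact_Icc (a := t₀) (b := T)).exists_bound_of_continuousOn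
      ((isSolution_flow hfc x).1.mono fun s hs => hs.1)
    refine ⟨Metric.ball x ρ, mem_nhdsWithin_of_mem_nhds (Metric.ball_mem_nhds x hρ), 1 + R, ?_⟩
    intro y hy t ht
    rw [mem_ball_iff_norm] at hy
    calc _ = ‖(flow f t t₀ y - flow f t t₀ x) + flow f t t₀ x‖ := by rw [sub_add_cancel]
      _ ≤ _ := norm_add_le _ _
      _ ≤ 1 + R := add_le_add (h y _ (isSolution_flow hfc y) hy t ht) (hR t ht)

/-- Solutions that start in a compact set are Lipschitz in the initial state, uniformly on bounded
time intervals. -/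
theorem exists_norm_flow_sub_le [ProperSpace X] (hf : IsRegular t₀ f)
    (hfc : IsForwardComplete f t₀) {K : Set X} (hK : IsCompact K) (T : ℝ) :
    ∃ C > 0, ∀ x ∈ K, ∀ y ∈ K, ∀ t ∈ Icc t₀ T,
      ‖flow f t t₀ x - flow f t t₀ y‖ ≤ C * ‖x - y‖ := by
  obtain ⟨R, hR⟩ := exists_norm_flow_le hf hfc hK T
  obtain ⟨L, hL⟩ := hf.bounded_fderiv T _ (isCompact_closedBall (0 : X) R)
  refine ⟨Real.exp (|L| * (T - t₀)), Real.exp_pos _, fun x hx y hy t ht => ?_⟩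
  have := (isSolution_flow hfc x).norm_sub_le hf (isSolution_flow hfc y) (L := L) ht.1
    fun r hr => by
      have hrT : r ∈ Icc t₀ T := ⟨hr.1.le, hr.2.le.trans ht.2⟩
      refine ⟨Metric.closedBall 0 R, convex_closedBall _ _, ?_, ?_, hL r hrT⟩
      · simpa using hR x hx r hrT
      · simpa using hR y hy r hrT
  refine this.trans ?_
  rw [mul_comm]
  gcongr
  · linarith [ht.1]
  · exact le_abs_self L
  · exact ht.2

end Compare

end InterEntropy

end

noncomputable section

namespace InterEntropy

/-! ### The network norm -/

theorem continuous_seminorm {X : Type*} [NormedAddCommGroup X] [NormedSpace ℝ X]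
    [FiniteDimensional ℝ X] (q : Seminorm ℝ X) : Continuous q :=
  continuousOn_univ.1 (q.convexOn.continuousOn isOpen_univ)

/-- A norm on a finite-dimensional space dominates the instance norm up to a constant. -/
theorem IsNorm.exists_norm_le {X : Type*} [NormedAddCommGroup X] [NormedSpace ℝ X]
    [FiniteDimensional ℝ X] {q : Seminorm ℝ X} (hq : IsNorm q) :
    ∃ C > 0, ∀ v, ‖v‖ ≤ C * q v := by
  have : ProperSpace X := FiniteDimensional.proper ℝ X
  rcases (Metric.sphere (0 : X) 1).eq_empty_or_nonempty with he | hne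
  · refine ⟨1, one_pos, fun v => ?_⟩
    by_cases hv : v = 0
    · simp [hv]
    · have : (‖v‖⁻¹ • v) ∈ Metric.sphere (0 : X) 1 := by simp [norm_smul, hv]
      rw [he] at this
      exact this.elim
  obtain ⟨u, hu, hmin⟩ := (isCompact_sphere (0 : X) 1).exists_isMinOn hne
    (continuous_seminorm q).continuousOn
  have hu0 : u ≠ 0 := by rintro rfl; simp at hu
  have hc : 0 < q u := lt_of_le_of_ne (apply_nonneg q u) fun h => hu0 (hq u h.symm)
  refine ⟨(q u)⁻¹, inv_pos.2 hc, fun v => ?_⟩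
  by_cases hv : v = 0
  · simp [hv]
  have hw : (‖v‖⁻¹ • v) ∈ Metric.sphere (0 : X) 1 := by simp [norm_smul, hv]
  have h1 : q u ≤ q (‖v‖⁻¹ • v) := hmin hw
  rw [map_smul_eq_mul, norm_inv, norm_norm, le_inv_mul_iff₀ (norm_pos_iff.2 hv)] at h1
  rw [le_inv_mul_iff₀ hc]
  linarith

theorem le_inducedNorm_mul {k l : ℕ} {p : Seminorm ℝ (Fin l → ℝ)} (hp : IsNorm p)
    (q : Seminorm ℝ (Fin k → ℝ)) (A : Matrix (Fin k) (Fin l) ℝ) (v : Fin l → ℝ) :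
    q (A.mulVec v) ≤ inducedNorm p q A * p v := by
  by_cases hv : v = 0
  · simp [hv]
  have hpv : 0 < p v := lt_of_le_of_ne (apply_nonneg p v) fun h => hv (hp v h.symm)
  have h : q (A.mulVec ((p v)⁻¹ • v)) ≤ inducedNorm p q A := by
    refine le_csSup (bddAbove_inducedNorm hp q A) ⟨_, ?_, rfl⟩
    rw [map_smul_eq_mul, norm_inv, Real.norm_of_nonneg hpv.le, inv_mul_cancel₀ hpv.ne']
  rw [Matrix.mulVec_smul, map_smul_eq_mul, norm_inv, Real.norm_of_nonneg hpv.le,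
    inv_mul_le_iff₀ hpv] at h
  linarith

variable {m : ℕ} {n : Fin m → ℕ}

/-- The norm `|(|x_1|_1, …, |x_m|_m)|_N` on the state space. -/
def networkSeminorm (pL : (i : Fin m) → Seminorm ℝ (Fin (n i) → ℝ))
    {pN : Seminorm ℝ (Fin m → ℝ)} (hmono : IsMonotone pN) : Seminorm ℝ (State n) :=
  Seminorm.of (fun x => pN fun i => pL i (x i))
    -- Monotonicity of `pN` is what turns the blockwise triangle inequalities into one for the
    -- composite.
    (fun x y => (hmono _ _ (fun i => by simp only [Pi.zero_apply]; positivity)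
      (fun i => apply_nonneg _ _) (fun i => map_add_le_add (pL i) (x i) (y i))).trans
        (map_add_le_add pN (fun i => pL i (x i)) (fun i => pL i (y i))))
    (fun a x => by
      rw [show ‖a‖ * pN (fun i => pL i (x i)) = pN (‖a‖ • fun i => pL i (x i)) by
        rw [map_smul_eq_mul, norm_norm]]
      congr 1
      funext i
      exact map_smul_eq_mul (pL i) a (x i))

variable {pL : (i : Fin m) → Seminorm ℝ (Fin (n i) → ℝ)} {pN : Seminorm ℝ (Fin m → ℝ)}

theorem networkSeminorm_apply (hmono : IsMonotone pN) (x : State n) :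
    networkSeminorm pL hmono x = pN fun i => pL i (x i) :=
  rfl

theorem isNorm_networkSeminorm (hpL : ∀ i, IsNorm (pL i)) (hpN : IsNorm pN)
    (hmono : IsMonotone pN) : IsNorm (networkSeminorm pL hmono) := fun x hx => by
  funext i
  exact hpL i _ (congrFun (hpN _ hx) i)

/-- The interconnection matrix of a block matrix. -/
def blockMeasureMatrix (pL : (i : Fin m) → Seminorm ℝ (Fin (n i) → ℝ))
    (B : (i j : Fin m) → Matrix (Fin (n i)) (Fin (n j)) ℝ) : Matrix (Fin m) (Fin m) ℝ :=
  Matrix.of fun i j =>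
    if i = j then matrixMeasure (pL i) (B i i) else inducedNorm (pL j) (pL i) (B i j)

/-- The diagonal block is kept together with the identity, so that it contributes a matrix measure
rather than a norm; `e` absorbs the gap between the difference quotient at `s` and its limit. -/
theorem seminorm_add_smul_block_le (hpL : ∀ i, IsNorm (pL i))
    (B : (i j : Fin m) → Matrix (Fin (n i)) (Fin (n j)) ℝ) (δ : State n) {s e : ℝ} (hs : 0 < s)
    (i : Fin m)
    (he : (inducedNorm (pL i) (pL i) (1 + s • B i i) - 1) / s ≤ matrixMeasure (pL i) (B i i) + e) :
    pL i (δ i + s • ∑ j, (B i j).mulVec (δ j)) ≤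
      ((1 + s • blockMeasureMatrix pL B).mulVec (fun j => pL j (δ j)) +
        (s * e) • fun j => pL j (δ j)) i := by
  have e1 : δ i + s • ∑ j, (B i j).mulVec (δ j) = (1 + s • B i i).mulVec (δ i) +
      s • ∑ j ∈ Finset.univ.erase i, (B i j).mulVec (δ j) := by
    rw [← Finset.add_sum_erase _ _ (Finset.mem_univ i), Matrix.add_mulVec, Matrix.one_mulVec,
      Matrix.smul_mulVec, smul_add]
    abel
  have e2 : ((1 + s • blockMeasureMatrix pL B).mulVec (fun j => pL j (δ j)) +
        (s * e) • fun j => pL j (δ j)) i =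
      (1 + s * (matrixMeasure (pL i) (B i i) + e)) * pL i (δ i) +
        s * ∑ j ∈ Finset.univ.erase i, inducedNorm (pL j) (pL i) (B i j) * pL j (δ j) := by
    have : ∑ j, blockMeasureMatrix pL B i j * pL j (δ j) =
        matrixMeasure (pL i) (B i i) * pL i (δ i) +
          ∑ j ∈ Finset.univ.erase i, inducedNorm (pL j) (pL i) (B i j) * pL j (δ j) := by
      rw [← Finset.add_sum_erase _ _ (Finset.mem_univ i)]
      congr 1
      · simp [blockMeasureMatrix]
      · refine Finset.sum_congr rfl fun j hj => ?_
        simp [blockMeasureMatrix, (Finset.ne_of_mem_erase hj).symm]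
    simp only [Pi.add_apply, Pi.smul_apply, smul_eq_mul, Matrix.add_mulVec, Matrix.one_mulVec,
      Matrix.smul_mulVec, Matrix.mulVec, dotProduct, this]
    ring
  rw [e1, e2]
  refine (map_add_le_add (pL i) _ _).trans (add_le_add ?_ ?_)
  · refine (le_inducedNorm_mul (hpL i) (pL i) _ _).trans ?_
    rw [div_le_iff₀ hs] at he
    gcongr
    linarith
  · rw [map_smul_eq_mul, Real.norm_of_nonneg hs.le]
    gcongr
    refine (Finset.le_sum_of_subadditive (pL i) (map_zero (pL i)).le (map_add_le_add (pL i)) _ _).trans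
      (Finset.sum_le_sum fun j _ => ?_)
    exact le_inducedNorm_mul (hpL j) (pL i) _ _

/-- The logarithmic growth of the network norm under a block matrix is controlled by the
interconnection matrix. -/
theorem dirDeriv_networkSeminorm_le (hm : 1 ≤ m) (hn : ∀ i, 1 ≤ n i) (hpL : ∀ i, IsNorm (pL i))
    (hpN : IsNorm pN) (hmono : IsMonotone pN)
    (B : (i j : Fin m) → Matrix (Fin (n i)) (Fin (n j)) ℝ) (δ : State n) :
    dirDeriv (networkSeminorm pL hmono) δ (fun i => ∑ j, (B i j).mulVec (δ j)) ≤
      matrixMeasure pN (blockMeasureMatrix pL B) * networkSeminorm pL hmono δ := by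
  let A := blockMeasureMatrix pL B
  -- Summing over the blocks gives one vanishing error that serves every row.
  let e : ℝ → ℝ := fun s =>
    ∑ i, |(inducedNorm (pL i) (pL i) (1 + s • B i i) - 1) / s - matrixMeasure (pL i) (B i i)|
  have he : Tendsto e (𝓝[>] 0) (𝓝 0) := by
    have : Tendsto e (𝓝[>] 0) (𝓝 (∑ i : Fin m,
        |matrixMeasure (pL i) (B i i) - matrixMeasure (pL i) (B i i)|)) :=
      tendsto_finsetSum _ fun i _ =>
        ((tendsto_matrixMeasure (hn i) (hpL i) (B i i)).sub_const _).abs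
    simpa using this
  have hlim := (((tendsto_matrixMeasure hm hpN A).add he).mul_const (networkSeminorm pL hmono δ))
  rw [add_zero] at hlim
  refine le_of_tendsto_of_tendsto (tendsto_dirDeriv _ _ _) hlim ?_
  filter_upwards [self_mem_nhdsWithin] with s hs
  have hs : 0 < s := hs
  have hei : ∀ i, (inducedNorm (pL i) (pL i) (1 + s • B i i) - 1) / s ≤
      matrixMeasure (pL i) (B i i) + e s := fun i => by
    have h1 := Finset.single_le_sum (f := fun i =>
      |(inducedNorm (pL i) (pL i) (1 + s • B i i) - 1) / s - matrixMeasure (pL i) (B i i)|)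
      (fun i _ => abs_nonneg _) (Finset.mem_univ i)
    have h2 := (le_abs_self _).trans h1
    have h3 : e s = ∑ i, |(inducedNorm (pL i) (pL i) (1 + s • B i i) - 1) / s -
      matrixMeasure (pL i) (B i i)| := rfl
    linarith
  have he0 : 0 ≤ e s := Finset.sum_nonneg fun i _ => abs_nonneg _
  let u : Fin m → ℝ := fun j => pL j (δ j)
  have hle := fun i => seminorm_add_smul_block_le hpL B δ hs i (hei i)
  -- Monotonicity requires nonnegative vectors. The majorant is nonnegative because it dominates
  -- seminorms, although diagonal entries of `A` may be negative.
  have h1 : networkSeminorm pL hmono (δ + s • fun i => ∑ j, (B i j).mulVec (δ j)) ≤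
      pN ((1 + s • A).mulVec u + (s * e s) • u) :=
    hmono _ _ (fun i => (apply_nonneg (pL i) _).trans (hle i)) (fun i => apply_nonneg (pL i) _) hle
  have h2 : pN ((1 + s • A).mulVec u + (s * e s) • u) ≤
      inducedNorm pN pN (1 + s • A) * pN u + s * e s * pN u := by
    refine (map_add_le_add pN _ _).trans (add_le_add (le_inducedNorm_mul hpN pN _ _) ?_)
    rw [map_smul_eq_mul, Real.norm_of_nonneg (by positivity)]
  have h3 : networkSeminorm pL hmono δ = pN u := rfl
  rw [h3] at *
  rw [div_le_iff₀ hs]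
  calc _ ≤ (inducedNorm pN pN (1 + s • A) - 1) * pN u + s * e s * pN u := by linarith
    _ = _ := by field_simp

theorem fderiv_apply_eq_jacobianBlock (f : ℝ → State n → State n) (t : ℝ) (v δ : State n) :
    fderiv ℝ (f t) v δ = fun i => ∑ j, (jacobianBlock f t v i j).mulVec (δ j) := by
  have hδ : δ = ∑ j, ∑ b, δ j b • (Pi.single j (Pi.single b 1) : State n) := by
    have h1 : δ = ∑ j, (Pi.single j (δ j) : State n) := (Finset.univ_sum_single δ).symm
    conv_lhs => rw [h1]
    refine Finset.sum_congr rfl fun j _ => ?_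
    have h2 : δ j = ∑ b, δ j b • (Pi.single b 1 : Fin (n j) → ℝ) := by
      funext a
      simp [Finset.sum_apply, Pi.single_apply]
    conv_lhs => rw [h2]
    simp_rw [← Pi.single_smul]
    exact map_sum (AddMonoidHom.single (fun j => Fin (n j) → ℝ) j) _ _
  conv_lhs => rw [hδ]
  funext i a
  simp only [map_sum, map_smul, Finset.sum_apply, Pi.smul_apply, Matrix.mulVec, dotProduct,
    jacobianBlock, Matrix.of_apply, smul_eq_mul]
  exact Finset.sum_congr rfl fun j _ => Finset.sum_congr rfl fun b _ => mul_comm _ _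

theorem dirDeriv_fderiv_le (hm : 1 ≤ m) (hn : ∀ i, 1 ≤ n i) (hpL : ∀ i, IsNorm (pL i))
    (hpN : IsNorm pN) (hmono : IsMonotone pN) (f : ℝ → State n → State n) (t : ℝ)
    (v δ : State n) :
    dirDeriv (networkSeminorm pL hmono) δ (fderiv ℝ (f t) v δ) ≤
      matrixMeasure pN (interMatrix pL f t v) * networkSeminorm pL hmono δ := by
  rw [fderiv_apply_eq_jacobianBlock]
  exact dirDeriv_networkSeminorm_le hm hn hpL hpN hmono (jacobianBlock f t v) δ

/-! ### Growth of the distance between solutions -/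

/-- If the matrix measure of the interconnection matrix is eventually at most `c ≥ 0` on the convex
hull of the reachable set, then solutions diverge at the exponential rate `c` at most. -/
theorem exists_norm_flow_sub_le_exp (hm : 1 ≤ m) (hn : ∀ i, 1 ≤ n i) (hpL : ∀ i, IsNorm (pL i))
    (hpN : IsNorm pN) (hmono : IsMonotone pN) {t₀ : ℝ} {f : ℝ → State n → State n}
    (hf : IsRegular t₀ f) (hfc : IsForwardComplete f t₀) {K : Set (State n)} (hK : IsCompact K)
    {c : ℝ} (hc : 0 ≤ c) (h : ∀ᶠ t in atTop, ∀ v ∈ convexHull ℝ (reachableSet f t t₀ K),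
      matrixMeasure pN (interMatrix pL f t v) ≤ c) :
    ∃ C > 0, ∀ x ∈ K, ∀ y ∈ K, ∀ t, t₀ ≤ t →
      ‖flow f t t₀ x - flow f t t₀ y‖ ≤ C * Real.exp (c * (t - t₀)) * ‖x - y‖ := by
  obtain ⟨T, hT₀, hT⟩ := ((eventually_ge_atTop t₀).and (eventually_forall_ge_atTop.2 h)).exists
  obtain ⟨C₀, hC₀, h₀⟩ := exists_norm_flow_sub_le hf hfc hK T
  let q := networkSeminorm pL hmono
  have hqc : Continuous q := continuous_seminorm q
  obtain ⟨C₁, hC₁, h₁⟩ := (isNorm_networkSeminorm hpL hpN hmono).exists_norm_le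
  obtain ⟨C₂, hC₂, h₂⟩ := Seminorm.bound_of_continuous_normedSpace q hqc
  -- Up to time `T` the constant `C₀` suffices, since `c ≥ 0`; afterwards `C₁` and `C₂` pay for
  -- passing to the network norm and back.
  refine ⟨max C₀ (C₁ * C₂ * C₀), lt_max_of_lt_left hC₀, fun x hx y hy t ht => ?_⟩
  rcases le_total t T with htT | htT
  · refine (h₀ x hx y hy t ⟨ht, htT⟩).trans ?_
    gcongr
    calc C₀ ≤ max C₀ (C₁ * C₂ * C₀) * 1 := by rw [mul_one]; exact le_max_left _ _
      _ ≤ _ := by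
        gcongr
        exact Real.one_le_exp (mul_nonneg hc (by linarith))
  · have key := (isSolution_flow hfc x).seminorm_sub_le hf.piecewise (isSolution_flow hfc y)
      (q := q) (c := c) hqc hT₀ htT fun r hr => by
        refine dirDeriv_image_sub_le q
          ((hf.contDiff r (hT₀.trans hr.1.le)).differentiable (by norm_num)) _ _ fun v hv => ?_
        refine (dirDeriv_fderiv_le hm hn hpL hpN hmono f r v _).trans ?_
        refine mul_le_mul_of_nonneg_right (hT r hr.1.le v ?_) (apply_nonneg _ _)
        exact (convex_convexHull ℝ _).segment_subset
          (subset_convexHull ℝ _ (mem_image_of_mem _ hy))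
          (subset_convexHull ℝ _ (mem_image_of_mem _ hx)) hv
    calc _ ≤ C₁ * q (flow f t t₀ x - flow f t t₀ y) := h₁ _
      _ ≤ C₁ * (q (flow f T t₀ x - flow f T t₀ y) * Real.exp (c * (t - T))) := by gcongr
      _ ≤ C₁ * (C₂ * (C₀ * ‖x - y‖) * Real.exp (c * (t - t₀))) := by
        gcongr
        exact (h₂ _).trans (by gcongr; exact h₀ x hx y hy T ⟨hT₀, le_rfl⟩)
      _ = C₁ * C₂ * C₀ * Real.exp (c * (t - t₀)) * ‖x - y‖ := by ring
      _ ≤ _ := by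
        gcongr
        exact le_max_right _ _

end InterEntropy

end

noncomputable section

namespace InterEntropy

/-! ### Spanning sets -/

section Span

variable {m : ℕ} {n : Fin m → ℕ}

/-- A compact set can be covered by `O(r ^ (-dim))` balls of radius `r` with centres in it. -/
theorem exists_finset_cover {K : Set (State n)} (hK : IsCompact K) :
    ∃ A > 0, ∀ r : ℝ, 0 < r → r ≤ 1 → ∃ E : Finset (State n), (E : Set (State n)) ⊆ K ∧
      (∀ y ∈ K, ∃ x ∈ E, ‖y - x‖ < r) ∧ (E.card : ℝ) ≤ (A / r) ^ (∑ i, n i) := by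
  obtain ⟨R, hR0, hR⟩ : ∃ R : ℝ, 0 ≤ R ∧ ∀ x ∈ K, ‖x‖ ≤ R := by
    obtain ⟨R, hR⟩ := hK.isBounded.exists_norm_le
    exact ⟨max R 0, le_max_right _ _, fun x hx => (hR x hx).trans (le_max_left _ _)⟩
  -- Each coordinate meets at most `2M + 1` grid intervals, where `M < 2R/r + 1`, and `2M + 1 ≤ (4R
  -- + 3)/r` because `r ≤ 1`.
  refine ⟨4 * R + 3, by linarith, fun r hr hr1 => ?_⟩
  -- `F` labels the cells of a grid of side `r/2`. One point of `K` is chosen in each occupied cell,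
  -- which keeps the centres in `K`.
  let F : State n → ((Σ i, Fin (n i)) → ℤ) := fun x k => ⌊x k.1 k.2 / (r / 2)⌋
  let M : ℕ := ⌈R / (r / 2)⌉₊
  let box : Finset ((Σ i, Fin (n i)) → ℤ) := Fintype.piFinset fun _ => Finset.Icc (-M : ℤ) M
  have hF : ∀ x ∈ K, F x ∈ box := by
    intro x hx
    refine Fintype.mem_piFinset.2 fun k => Finset.mem_Icc.2 ?_
    have h1 : |x k.1 k.2| ≤ R := (norm_le_pi_norm (x k.1) k.2).trans
      ((norm_le_pi_norm x k.1).trans (hR x hx))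
    have h2 : |x k.1 k.2 / (r / 2)| ≤ M := by
      rw [abs_div, abs_of_pos (half_pos hr)]
      exact (by gcongr : _ ≤ R / (r / 2)).trans (Nat.le_ceil _)
    rw [abs_le] at h2
    refine ⟨Int.le_floor.2 (by push_cast; exact h2.1), ?_⟩
    exact_mod_cast (Int.floor_le _).trans h2.2
  obtain ⟨S, hSK, hS⟩ := Set.exists_subset_bijOn K F
  have hfin : S.Finite := by
    refine Set.Finite.of_finite_image (box.finite_toSet.subset ?_) hS.injOn
    rintro _ ⟨x, hx, rfl⟩
    exact hF x (hSK hx)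
  refine ⟨hfin.toFinset, by simpa using hSK, fun y hy => ?_, ?_⟩
  · obtain ⟨x, hx, hxy⟩ := hS.surjOn (mem_image_of_mem F hy)
    refine ⟨x, hfin.mem_toFinset.2 hx, lt_of_le_of_lt ?_ (half_lt_self hr)⟩
    refine (pi_norm_le_iff_of_nonneg (half_pos hr).le).2 fun i =>
      (pi_norm_le_iff_of_nonneg (half_pos hr).le).2 fun a => ?_
    have h := Int.abs_sub_lt_one_of_floor_eq_floor (congrFun hxy ⟨i, a⟩).symm
    rw [← sub_div, abs_div, abs_of_pos (half_pos hr), div_lt_one (half_pos hr)] at h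
    exact h.le
  · have h1 : hfin.toFinset.card ≤ box.card :=
      Finset.card_le_card_of_injOn F (fun x hx => hF x (hSK (hfin.mem_toFinset.1 hx)))
        (by simpa using hS.injOn)
    have h2 : box.card = (2 * M + 1) ^ (∑ i, n i) := by
      simp only [box, Fintype.card_piFinset, Int.card_Icc, Finset.prod_const, Finset.card_univ,
        Fintype.card_sigma, Fintype.card_fin]
      congr 1
      omega
    have h3 : ((2 * M + 1 : ℕ) : ℝ) ≤ (4 * R + 3) / r := by
      have h4 : (M : ℝ) < R / (r / 2) + 1 := Nat.ceil_lt_add_one (by positivity)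
      have h5 : R / (r / 2) = 2 * R / r := by field_simp
      have h6 : (1 : ℝ) ≤ 1 / r := by rwa [le_div_iff₀ hr, one_mul]
      have h7 : (4 * R + 3) / r = 2 * (2 * R / r) + 3 * (1 / r) := by ring
      push_cast
      linarith
    calc (hfin.toFinset.card : ℝ) ≤ ((2 * M + 1) ^ (∑ i, n i) : ℕ) := by exact_mod_cast h2 ▸ h1
      _ = ((2 * M + 1 : ℕ) : ℝ) ^ (∑ i, n i) := by push_cast; rfl
      _ ≤ _ := by gcongr

/-- Exponential divergence of solutions at the rate `c` at most bounds the growth of spanning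
sets by `c` times the dimension. -/
theorem spanGrowth_le (p : Seminorm ℝ (State n)) {f : ℝ → State n → State n} {t₀ : ℝ}
    {K : Set (State n)} (hK : IsCompact K) {C c : ℝ} (hC : 0 < C) (hc : 0 ≤ c)
    (h : ∀ x ∈ K, ∀ y ∈ K, ∀ t, t₀ ≤ t →
      ‖flow f t t₀ x - flow f t t₀ y‖ ≤ C * Real.exp (c * (t - t₀)) * ‖x - y‖)
    {ε : ℝ} (hε : 0 < ε) :
    spanGrowth p f t₀ ε K ≤ (((∑ i, n i : ℕ) * c : ℝ) : EReal) := by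
  obtain ⟨A, hA, hcov⟩ := exists_finset_cover hK
  obtain ⟨P, hP, hp⟩ := Seminorm.bound_of_continuous_normedSpace p (continuous_seminorm p)
  -- The first entry makes the radius `r` below small enough for precision `ε`; the second
  -- guarantees `r ≤ 1`, as the cover requires.
  let D : ℝ := max (P * C / ε) 1
  have hD : 0 < D := lt_max_of_lt_right one_pos
  let N : ℕ := ∑ i, n i
  have hlim : Tendsto (fun T : ℝ => (((N * Real.log (A * D)) / T + N * c : ℝ) : EReal)) atTop
      (𝓝 ((N * c : ℝ) : EReal)) := by
    refine (continuous_coe_real_ereal.tendsto _).comp ?_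
    simpa using (tendsto_const_nhds.div_atTop tendsto_id).add_const (N * c : ℝ)
  refine le_trans (limsup_le_limsup ?_) hlim.limsup_eq.le
  filter_upwards [eventually_gt_atTop (0 : ℝ)] with T hT
  let r : ℝ := (D * Real.exp (c * T))⁻¹
  have hr : 0 < r := inv_pos.2 (mul_pos hD (Real.exp_pos _))
  have hr1 : r ≤ 1 := inv_le_one_of_one_le₀ (one_le_mul_of_one_le_of_one_le (le_max_right _ _)
    (Real.one_le_exp (mul_nonneg hc hT.le)))
  obtain ⟨E, hEK, hE, hcard⟩ := hcov r hr hr1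
  have hspan : IsSpanning p f t₀ ε T K E := by
    refine ⟨hEK, fun y hy => ?_⟩
    obtain ⟨x, hx, hxy⟩ := hE y hy
    refine ⟨x, hx, fun t ht => ?_⟩
    have hD' : P * C ≤ ε * D := by
      rw [← div_le_iff₀' hε]; exact le_max_left _ _
    calc _ ≤ P * ‖flow f t t₀ y - flow f t t₀ x‖ := hp _
      _ ≤ P * (C * Real.exp (c * (t - t₀)) * ‖y - x‖) := by
        gcongr; exact h y hy x (hEK hx) t ht.1
      _ = P * C * (Real.exp (c * (t - t₀)) * ‖y - x‖) := by ring
      _ ≤ ε * D * (Real.exp (c * T) * ‖y - x‖) := by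
        gcongr; linarith [ht.2]
      _ < ε * D * (Real.exp (c * T) * r) := by gcongr
      _ = ε := by simp only [r]; field_simp
  have hB : 0 < (A / r) ^ N := by positivity
  have h1 : (spanNumber p f t₀ ε T K : ENNReal) ≤ ENNReal.ofReal ((A / r) ^ N) := by
    have h2 : spanNumber p f t₀ ε T K ≤ (E.card : ℕ∞) := iInf₂_le E hspan
    calc (spanNumber p f t₀ ε T K : ENNReal) ≤ ((E.card : ℕ∞) : ENNReal) := by exact_mod_cast h2
      _ = ENNReal.ofReal (E.card : ℝ) := by simp
      _ ≤ _ := ENNReal.ofReal_le_ofReal hcard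
  have h3 : Real.log ((A / r) ^ N) = N * Real.log (A * D) + N * c * T := by
    have : A / r = (A * D) * Real.exp (c * T) := by simp only [r, div_inv_eq_mul]; ring
    rw [Real.log_pow, this, Real.log_mul (by positivity) (Real.exp_pos _).ne', Real.log_exp]
    ring
  have h4 := ENNReal.log_monotone h1
  rw [ENNReal.log_ofReal_of_pos hB, h3] at h4
  refine (EReal.div_le_div_right_of_nonneg (by exact_mod_cast hT.le) h4).trans_eq ?_
  rw [← EReal.coe_div, add_div, mul_div_cancel_right₀ _ hT.ne']

end Span

end InterEntropy

end

/-! ### The entropy bound -/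

theorem corollary2 {m : ℕ} (hm : 1 ≤ m) (n : Fin m → ℕ) (hn : ∀ i, 1 ≤ n i)
    -- local norms on the spaces `ℝ^{n_i}` and a monotone network norm on `ℝ^m`
    (pL : (i : Fin m) → Seminorm ℝ (Fin (n i) → ℝ)) (hpL : ∀ i, InterEntropy.IsNorm (pL i))
    (pN : Seminorm ℝ (Fin m → ℝ)) (hpN : InterEntropy.IsNorm pN)
    (hmono : InterEntropy.IsMonotone pN)
    -- the interconnected system
    (t₀ : ℝ) (f : ℝ → InterEntropy.State n → InterEntropy.State n)
    (hf : InterEntropy.IsRegular t₀ f) (hfc : InterEntropy.IsForwardComplete f t₀)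
    -- the initial set
    (K : Set (InterEntropy.State n)) (hK : IsCompact K) (hKint : (interior K).Nonempty)
    -- the norm on the state space in the definition of entropy
    (p : Seminorm ℝ (InterEntropy.State n)) (hp : InterEntropy.IsNorm p) :
    InterEntropy.entropy p f t₀ K ≤
      ((∑ i, n i : ℕ) : EReal) * max (InterEntropy.muHat pL pN f t₀ K) 0 := by
  have hN : 0 < ∑ i, n i :=
    (hn ⟨0, hm⟩).trans (Finset.single_le_sum (fun i _ => Nat.zero_le (n i)) (Finset.mem_univ _))
  refine iSup₂_le fun ε hε => ?_
  -- Strict inequality turns the limsup into a bound valid for all large times.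
  have key : ∀ c : ℝ, max (InterEntropy.muHat pL pN f t₀ K) 0 < c →
      InterEntropy.spanGrowth p f t₀ ε K ≤ (((∑ i, n i : ℕ) * c : ℝ) : EReal) := by
    intro c hc
    obtain ⟨hc1, hc2⟩ := max_lt_iff.1 hc
    have hc0 : 0 ≤ c := by exact_mod_cast hc2.le
    obtain ⟨C, hC, h⟩ := InterEntropy.exists_norm_flow_sub_le_exp hm hn hpL hpN hmono hf hfc hK hc0
      (by
        filter_upwards [eventually_lt_of_limsup_lt hc1] with t ht v hv
        have h1 := (le_iSup₂ (f := fun v _ => ((InterEntropy.matrixMeasure pN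
          (InterEntropy.interMatrix pL f t v) : ℝ) : EReal)) v hv).trans ht.le
        exact_mod_cast h1)
    exact InterEntropy.spanGrowth_le p hK hC hc0 h hε
  induction hM : max (InterEntropy.muHat pL pN f t₀ K) 0 with
  | bot => exact absurd (le_max_right (InterEntropy.muHat pL pN f t₀ K) 0) (by simp [hM])
  -- Positive dimension matters here, since `0 * ⊤ = 0` in `EReal`.
  | top => rw [EReal.mul_top_of_pos (by exact_mod_cast hN)]; exact le_top
  | coe M =>
    rw [hM] at key
    have hlim : Tendsto (fun c : ℝ => (((∑ i, n i : ℕ) * c : ℝ) : EReal)) (𝓝[>] M)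
        (𝓝 (((∑ i, n i : ℕ) * M : ℝ) : EReal)) := by
      refine (continuous_coe_real_ereal.tendsto _).comp ?_
      exact (tendsto_id.const_mul _).mono_left nhdsWithin_le_nhds
    have := ge_of_tendsto hlim (by
      filter_upwards [self_mem_nhdsWithin] with c hc
      exact key c (by exact_mod_cast hc))
    rwa [EReal.coe_mul, EReal.coe_natCast] at this
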